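/- Let $A=K[x_1,\dots,x_n]$ be a polynomial ring over a field $K$, graded by total degree. Let $S$ be a full semigroup of monomials in $x_1,\dots,x_n$ (that is, if $a,b,c$ are monomials with $ab=c$ and $b,c\in S$, then $a\in S$), and let $R=K[S]\subseteq A$ be the $K$-subalgebra generated by $S$. Let $\mathfrak m$ be the homogeneous maximal ideal of $R$ (the elements with zero constant term). Assume that $S$ contains a monomial $\mu$ in which every variable $x_i$ occurs with positive exponent. For $t\ge 1$ let $\mathfrak a_t$ be the ideal of $R$ generated by the monomials in $S$ that do not divide $\mu^t$ in $R$. An $R$-module $M$ is said to satisfy condition $(*)$ if at least one of the following holds: (a) $M$ admits a grading (by $\mathbb Z$ or, more generally, by $\mathbb Q$) making it a graded $R$-module, and no direct summand of $M$ is isomorphic to $R$; (b) no direct summand of the $R_{\mathfrak m}$-module $M_{\mathfrak m}$ is isomorphic to $R_{\mathfrak m}$. 1. For every $t\ge1$ the ideal $\mathfrak a_t$ is irreducible and $\mathfrak m$-primary, and the image of $\mu^t$ generates the socle $(0:_{R/\mathfrak a_t}\mathfrak m)$ of $R/\mathfrak a_t$. 2. $\mathfrak a_1\supseteq\mathfrak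 a_2\supseteq\mathfrak a_3\supseteq\cdots$, and this sequence is cofinal with $\mathfrak m\supseteq\mathfrak m^2\supseteq\mathfrak m^3\supseteq\cdots$: for every $k\ge1$ there is $t\ge1$ with $\mathfrak a_t\subseteq\mathfrak m^k$, and for every $t\ge1$ there is $k\ge1$ with $\mathfrak m^k\subseteq\mathfrak a_t$. 3. Let $M$ be a finitely generated $R$-module with no free summands, in the sense that $M$ satisfies $(*)$. Then $\mu^tM\subseteq\mathfrak a_tM$ for all $t\gg0$. 4. Suppose that $K$ is perfect of characteristic $p>0$, let $q=p^e$ with $e\ge0$, and let $R^{1/q}$ be the ring of $q$-th roots of elements of $R$ in an algebraic closure of the fraction field of $R$. Let $R^{1/q}\cong R^{a_q}\oplus M_q$ be an isomorphism of $R$-modules, where $M_q$ has no free summands in the sense that it satisfies $(*)$. Then $$a_q=\ell\left(\frac{R}{\mathfrak a_t^{[q]}:_R\mu^{tq}}\right)\quad\text{for all } t\gg0,$$ where $\ell$ denotes length as an $R$-module and $\mathfrak a_t^{[q]}$ is the ideal generated by the $q$-th powers of the elements of $\mathfrak a_t$. -/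

import Mathlib

/-- A semigroup of monomials, written additively as a set of exponent vectors, is full if
`a + b = c` with `b, c ∈ S` forces `a ∈ S`, for all exponent vectors `a`. -/
def IsFullSemigroup {n : ℕ} (S : AddSubmonoid (Fin n →₀ ℕ)) : Prop :=
  ∀ a b c : Fin n →₀ ℕ, a + b = c → b ∈ S → c ∈ S → a ∈ S

/-- The `K`-subalgebra of `K[x_1, …, x_n]` generated by the monomials with exponents in `S`. -/
noncomputable def monomialSubalgebra {n : ℕ} (K : Type*) [Field K]
    (S : AddSubmonoid (Fin n →₀ ℕ)) : Subalgebra K (MvPolynomial (Fin n) K) :=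
  Algebra.adjoin K ((fun s => MvPolynomial.monomial s (1 : K)) '' (S : Set (Fin n →₀ ℕ)))

/-- The ring `R`: the subalgebra `monomialSubalgebra K S`, regarded as a ring in its own right. -/
def MonomialRing {n : ℕ} (K : Type*) [Field K] (S : AddSubmonoid (Fin n →₀ ℕ)) : Type _ :=
  monomialSubalgebra K S

namespace MonomialRing

variable {n : ℕ} (K : Type*) [Field K] (S : AddSubmonoid (Fin n →₀ ℕ))

noncomputable instance : CommRing (MonomialRing K S) :=
  inferInstanceAs (CommRing (monomialSubalgebra K S))

noncomputable instance : Algebra K (MonomialRing K S) :=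
  inferInstanceAs (Algebra K (monomialSubalgebra K S))

instance : IsDomain (MonomialRing K S) :=
  inferInstanceAs (IsDomain (monomialSubalgebra K S))

instance (p : ℕ) [CharP K p] : CharP (MonomialRing K S) p :=
  charP_of_injective_algebraMap (FaithfulSMul.algebraMap_injective K (MonomialRing K S)) p

/-- The inclusion `R ⊆ K[x_1, …, x_n]`. -/
noncomputable def incl : MonomialRing K S →ₐ[K] MvPolynomial (Fin n) K :=
  (monomialSubalgebra K S).val

variable {S} in
/-- The monomial with exponent vector `s ∈ S`, as an element of `R`. -/
noncomputable def mono (s : S) : MonomialRing K S :=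
  ⟨MvPolynomial.monomial (s : Fin n →₀ ℕ) 1, Algebra.subset_adjoin ⟨s, s.2, rfl⟩⟩

end MonomialRing

open MonomialRing (mono)

/-- The homogeneous maximal ideal of `R`: the elements whose constant term is zero, that is, all
of whose nonzero homogeneous components have positive degree. -/
noncomputable def homogeneousMaximalIdeal {n : ℕ} (K : Type*) [Field K]
    (S : AddSubmonoid (Fin n →₀ ℕ)) : Ideal (MonomialRing K S) :=
  RingHom.ker ((MvPolynomial.constantCoeff (R := K) (σ := Fin n)).comp
    (MonomialRing.incl K S).toRingHom)

instance homogeneousMaximalIdeal_isPrime {n : ℕ} (K : Type*) [Field K]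
    (S : AddSubmonoid (Fin n →₀ ℕ)) : (homogeneousMaximalIdeal K S).IsPrime :=
  RingHom.ker_isPrime _

/-- The ideal `𝔞_t`, generated by the monomials of the subring that do not divide `μ ^ t`
(divisibility in the subring). -/
noncomputable def labelIdeal {n : ℕ} (K : Type*) [Field K] {S : AddSubmonoid (Fin n →₀ ℕ)}
    (u : S) (t : ℕ) : Ideal (MonomialRing K S) :=
  Ideal.span {r | ∃ s : S, r = mono K s ∧ ¬ r ∣ mono K u ^ t}

/-- An ideal `I` is `𝔪`-primary: it is primary with radical `𝔪`. -/
def IsPrimaryTo {R : Type*} [CommRing R] (m I : Ideal R) : Prop :=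
  I.IsPrimary ∧ I.radical = m

/-- The socle of `R ⧸ I` relative to the maximal ideal `𝔪`: the elements killed by `𝔪`. -/
def quotientSocle {R : Type*} [CommRing R] (m I : Ideal R) : Submodule R (R ⧸ I) where
  carrier := {x | ∀ r ∈ m, r • x = 0}
  add_mem' := fun hx hy r hr => by rw [smul_add, hx r hr, hy r hr, add_zero]
  zero_mem' := fun r _ => smul_zero r
  smul_mem' := fun c x hx r hr => by rw [smul_comm, hx r hr, smul_zero]

/-- `M` has no (nonzero) free summand: no direct summand of `M` is isomorphic to `R`. -/
def HasNoFreeSummand (R M : Type*) [CommRing R] [AddCommGroup M] [Module R M] : Prop :=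
  ¬ ∃ P Q : Submodule R M, IsCompl P Q ∧ Nonempty (P ≃ₗ[R] R)

/-- The subgroups `𝓜 d`, `d ∈ ℚ`, make `M` a graded module over the monomial subring with its
grading by total degree. Rational degrees are allowed because `R^{1/q}` has degrees in
`(1/q)ℕ`; integer gradings are the special case in which the other pieces are zero. -/
structure IsGradedModule {n : ℕ} {K : Type*} [Field K] {S : AddSubmonoid (Fin n →₀ ℕ)}
    {M : Type*} [AddCommGroup M] [Module (MonomialRing K S) M]
    (𝓜 : ℚ → AddSubgroup M) : Prop where
  isInternal : DirectSum.IsInternal 𝓜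
  smul_mem : ∀ (d : ℕ) (r : MonomialRing K S),
    (MonomialRing.incl K S r).IsHomogeneous d →
      ∀ (c : ℚ) (x : M), x ∈ 𝓜 c → r • x ∈ 𝓜 ((d : ℚ) + c)

/-- The Frobenius power `I^{[q]}`: the ideal generated by the `q`-th powers of elements of `I`. -/
def Ideal.frobPow {R : Type*} [CommRing R] (I : Ideal R) (q : ℕ) : Ideal R :=
  Ideal.span ((fun x => x ^ q) '' (I : Set R))

/-- The ring `R^{1/q}`, `q = p ^ e`, of `q`-th roots of elements of a domain `R` of
characteristic `p`, inside an algebraic closure of the fraction field of `R`. -/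
noncomputable def rootRing (R : Type*) [CommRing R] [IsDomain R] (p : ℕ) [Fact p.Prime]
    [CharP R p] (e : ℕ) : Subalgebra R (AlgebraicClosure (FractionRing R)) where
  carrier := {x | ∃ r : R, x ^ p ^ e = algebraMap R (AlgebraicClosure (FractionRing R)) r}
  mul_mem' := by
    rintro x y ⟨r, hr⟩ ⟨s, hs⟩
    exact ⟨r * s, by rw [mul_pow, hr, hs, map_mul]⟩
  add_mem' := by
    rintro x y ⟨r, hr⟩ ⟨s, hs⟩
    have : CharP (FractionRing R) p :=
      charP_of_injective_algebraMap (IsFractionRing.injective R (FractionRing R)) p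
    exact ⟨r + s, by rw [add_pow_char_pow, hr, hs, map_add]⟩
  algebraMap_mem' := fun r => ⟨r ^ p ^ e, by rw [map_pow]⟩

open MonomialRing

/-! ### Monomials and coefficients in `R = K[S]` -/

namespace MonomialRing

variable {n : ℕ} {K : Type*} [Field K] {S : AddSubmonoid (Fin n →₀ ℕ)}

/-! Fullness of `S` makes divisibility of monomials in `R` the same as comparison of exponents.
Hence `𝔞_t` consists of the elements of `R` with no term dividing `μ ^ t` (`mem_labelIdeal_iff`). In
`R ⧸ 𝔞_t` every nonzero element has a monomial multiple that is a nonzero scalar times `μ ^ t`. This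
gives irreducibility and the socle, while degree estimates and finite generation of `S` give
cofinality.

For part 3, suppose `μ ^ t x ∉ 𝔞_t M`. Since `R ⧸ 𝔞_t` is self-injective with socle `μ ^ t`, some
map `M → R ⧸ 𝔞_t` sends `x` to a unit (`exists_linearMap_quotient_labelIdeal`). For large `t`,
Artin–Rees replaces it by a map `M → R` that agrees with it modulo `𝔪`
(`Ideal.exists_forall_exists_linearMap_sub_mem`). A map `M → R` with a value outside `𝔪` splits off
a free summand, after localizing or after passing to a homogeneous component, against `(*)`.

For part 4, the `q`-th power map identifies `R^{1/q}` with `R` and `𝔞_t R^{1/q}` with `𝔞_t^{[q]}`.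
Hence `r` lies in the colon ideal iff `μ ^ t r^{1/q} ∈ 𝔞_t R^{1/q}`. By part 3 the summand `M_q`
imposes no condition, and since `𝔞_t : μ ^ t = 𝔪`, the quotient is `(R ⧸ 𝔪)^{a_q}` up to a Frobenius
twist of scalars. -/

lemma incl_injective : Function.Injective (incl K S) := Subtype.val_injective

@[simp]
lemma incl_mono (s : S) : incl K S (mono K s) = MvPolynomial.monomial (s : Fin n →₀ ℕ) 1 := rfl

lemma mono_zero : mono K (0 : S) = 1 := incl_injective (by simp)

lemma mono_add (s t : S) : mono K (s + t) = mono K s * mono K t :=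
  incl_injective (by simp [MvPolynomial.monomial_mul])

lemma mono_pow (s : S) (t : ℕ) : mono K s ^ t = mono K (t • s) :=
  incl_injective (by simp [MvPolynomial.monomial_pow])

lemma mem_of_coeff_ne_zero (r : MonomialRing K S) {s : Fin n →₀ ℕ}
    (h : (incl K S r).coeff s ≠ 0) : s ∈ S := by
  obtain ⟨f, hf⟩ := r
  change f.coeff s ≠ 0 at h
  revert s
  refine Algebra.adjoin_induction (p := fun f _ => ∀ {s}, f.coeff s ≠ 0 → s ∈ S)
    ?_ ?_ ?_ ?_ hf
  · rintro _ ⟨v, hv, rfl⟩ s hs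
    simp only [MvPolynomial.coeff_monomial, ne_eq, ite_eq_right_iff, not_forall] at hs
    exact hs.1 ▸ hv
  · intro c s hs
    rw [MvPolynomial.algebraMap_eq, MvPolynomial.coeff_C] at hs
    simp only [ne_eq, ite_eq_right_iff, not_forall] at hs
    exact hs.1 ▸ S.zero_mem
  · intro f g _ _ hf hg s hs
    by_cases h : f.coeff s = 0
    · exact hg (by simpa [h] using hs)
    · exact hf h
  · intro f g _ _ hf hg s hs
    rw [MvPolynomial.coeff_mul] at hs
    obtain ⟨⟨a, b⟩, hab, h⟩ := Finset.exists_ne_zero_of_sum_ne_zero hs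
    rw [← Finset.HasAntidiagonal.mem_antidiagonal.1 hab]
    exact S.add_mem (hf (left_ne_zero_of_mul h)) (hg (right_ne_zero_of_mul h))

/-- Reduces every `K`-linear condition on `R`, such as linearity of a map, to monomials. -/
lemma mem_of_forall_mono_mem (V : Submodule K (MonomialRing K S)) (r : MonomialRing K S)
    (h : ∀ s : S, (incl K S r).coeff s ≠ 0 → mono K s ∈ V) : r ∈ V := by
  classical
  have key : r = ∑ s ∈ (incl K S r).support.attach,
      (incl K S r).coeff s.1 • mono K ⟨s.1, mem_of_coeff_ne_zero r
        (MvPolynomial.mem_support_iff.1 s.2)⟩ := by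
    apply incl_injective
    conv_lhs => rw [(incl K S r).as_sum, ← Finset.sum_attach]
    rw [map_sum]
    refine Finset.sum_congr rfl fun s _ => ?_
    rw [map_smul, incl_mono, MvPolynomial.smul_monomial, smul_eq_mul, mul_one]
  rw [key]
  exact V.sum_mem fun s _ => V.smul_mem _ (h _ (MvPolynomial.mem_support_iff.1 s.2))

lemma exists_incl_eq (f : MvPolynomial (Fin n) K) (h : ∀ s, f.coeff s ≠ 0 → s ∈ S) :
    ∃ r : MonomialRing K S, incl K S r = f := by
  suffices h : f ∈ monomialSubalgebra K S from ⟨(⟨f, h⟩ : monomialSubalgebra K S), rfl⟩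
  rw [f.as_sum]
  refine sum_mem fun s hs => ?_
  rw [← mul_one (f.coeff s), ← smul_eq_mul, ← MvPolynomial.smul_monomial]
  refine Subalgebra.smul_mem _ ?_ _
  exact Algebra.subset_adjoin ⟨s, h s (MvPolynomial.mem_support_iff.1 hs), rfl⟩

lemma coeff_mono_mul (s : S) (r : MonomialRing K S) (v : Fin n →₀ ℕ) :
    (incl K S (mono K s * r)).coeff v =
      if (s : Fin n →₀ ℕ) ≤ v then (incl K S r).coeff (v - (s : Fin n →₀ ℕ)) else 0 := by
  rw [map_mul, incl_mono, MvPolynomial.coeff_monomial_mul']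
  simp

/-- Fullness puts the quotient of two monomials of `S` back in `S` whenever it exists in the
polynomial ring. -/
lemma mono_dvd_mono_iff (hS : IsFullSemigroup S) (s t : S) :
    mono K s ∣ mono K t ↔ (s : Fin n →₀ ℕ) ≤ t := by
  constructor
  · rintro ⟨r, hr⟩
    by_contra h
    have := congrArg (fun x => (incl K S x).coeff (t : Fin n →₀ ℕ)) hr
    rw [coeff_mono_mul, if_neg h] at this
    simp at this
  · intro h
    refine ⟨mono K ⟨t - s, hS _ s t (tsub_add_cancel_of_le h) s.2 t.2⟩, ?_⟩
    rw [← mono_add]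
    congr 1
    exact Subtype.ext (add_tsub_cancel_of_le h).symm

lemma isHomogeneous_mono (s : S) : (incl K S (mono K s)).IsHomogeneous (s : Fin n →₀ ℕ).degree := by
  rw [incl_mono]
  exact MvPolynomial.isHomogeneous_monomial _ rfl

end MonomialRing


/-! ### The ideals `𝔞_t`: irreducibility, socle and cofinality -/

section LabelIdeal

variable {n : ℕ} {K : Type*} [Field K] {S : AddSubmonoid (Fin n →₀ ℕ)}

lemma mem_homogeneousMaximalIdeal {r : MonomialRing K S} :
    r ∈ homogeneousMaximalIdeal K S ↔ (incl K S r).coeff 0 = 0 := Iff.rfl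

lemma mono_mem_homogeneousMaximalIdeal {s : S} :
    mono K s ∈ homogeneousMaximalIdeal K S ↔ (s : Fin n →₀ ℕ) ≠ 0 := by
  rw [mem_homogeneousMaximalIdeal, incl_mono, MvPolynomial.coeff_monomial]
  simp

lemma homogeneousMaximalIdeal_isMaximal : (homogeneousMaximalIdeal K S).IsMaximal := by
  refine RingHom.ker_isMaximal_of_surjective _ fun c => ⟨algebraMap K _ c, ?_⟩
  change MvPolynomial.constantCoeff (incl K S (algebraMap K _ c)) = c
  rw [AlgHom.commutes, MvPolynomial.algebraMap_eq, MvPolynomial.constantCoeff_C]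

/-- The monomials not dividing `μ ^ t` are stable under multiplication by monomials of `S`, so their
`K`-span is already an ideal. All later facts about `𝔞_t` are read off from coefficients. -/
lemma mem_labelIdeal_iff (hS : IsFullSemigroup S) (u : S) (t : ℕ) (r : MonomialRing K S) :
    r ∈ labelIdeal K u t ↔
      ∀ s ≤ t • (u : Fin n →₀ ℕ), (incl K S r).coeff s = 0 := by
  have hdvd : ∀ s : S, mono K s ∣ mono K u ^ t ↔ (s : Fin n →₀ ℕ) ≤ t • (u : Fin n →₀ ℕ) :=
    fun s => by rw [mono_pow, mono_dvd_mono_iff hS]; rfl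
  constructor
  · intro h
    refine Submodule.span_induction ?_ ?_ ?_ ?_ h
    · rintro _ ⟨v, rfl, hv⟩ s hs
      rw [hdvd] at hv
      rw [incl_mono, MvPolynomial.coeff_monomial, if_neg]
      rintro rfl
      exact hv hs
    · simp
    · intro x y _ _ hx hy s hs
      rw [map_add, MvPolynomial.coeff_add, hx s hs, hy s hs, add_zero]
    · intro a x _ hx s hs
      rw [smul_eq_mul, map_mul, MvPolynomial.coeff_mul]
      refine Finset.sum_eq_zero fun v hv => ?_
      rw [hx v.2 ((le_add_self.trans_eq (Finset.HasAntidiagonal.mem_antidiagonal.1 hv)).trans hs),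
          mul_zero]
  · intro h
    refine mem_of_forall_mono_mem ((labelIdeal K u t).restrictScalars K) r fun s hs => ?_
    refine Ideal.subset_span ⟨s, rfl, fun hd => hs (h s ((hdvd s).1 hd))⟩

lemma mono_mem_labelIdeal_iff (hS : IsFullSemigroup S) (u : S) (t : ℕ) (s : S) :
    mono K s ∈ labelIdeal K u t ↔ ¬ (s : Fin n →₀ ℕ) ≤ t • (u : Fin n →₀ ℕ) := by
  rw [mem_labelIdeal_iff hS]
  constructor
  · intro h hs
    simpa using h s hs
  · intro h v hv
    rw [incl_mono, MvPolynomial.coeff_monomial, if_neg]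
    rintro rfl
    exact h hv

lemma mono_pow_notMem_labelIdeal (hS : IsFullSemigroup S) (u : S) (t : ℕ) :
    mono K u ^ t ∉ labelIdeal K u t := by
  rw [mono_pow, mono_mem_labelIdeal_iff hS, not_not]
  exact le_rfl

lemma labelIdeal_anti (hS : IsFullSemigroup S) (u : S) : Antitone (labelIdeal K u) := by
  intro t t' h r hr
  rw [mem_labelIdeal_iff hS] at hr ⊢
  exact fun s hs => hr s (hs.trans (nsmul_le_nsmul_left zero_le h))

/-- An element outside `𝔞_t` can be multiplied into `μ ^ t` modulo `𝔞_t`. -/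
lemma exists_mul_sub_mem_labelIdeal (hS : IsFullSemigroup S) (u : S) (t : ℕ)
    {r : MonomialRing K S} (hr : r ∉ labelIdeal K u t) :
    ∃ (b : S) (c : K), c ≠ 0 ∧ mono K b * r - c • mono K u ^ t ∈ labelIdeal K u t := by
  classical
  rw [mem_labelIdeal_iff hS] at hr
  push Not at hr
  -- Take a minimal exponent `s` of `r` below that of `μ ^ t`, and multiply by the complementary
  -- monomial. Any term that stays below `μ ^ t` came from an exponent at most `s`, so by minimality
  -- from `s` itself.
  obtain ⟨s, ⟨hs, hs0⟩, hmin⟩ := WellFounded.has_min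
    (wellFounded_lt (α := Fin n →₀ ℕ))
    {s | s ≤ t • (u : Fin n →₀ ℕ) ∧ (incl K S r).coeff s ≠ 0} hr
  have hb : t • (u : Fin n →₀ ℕ) - s ∈ S :=
    hS _ s _ (tsub_add_cancel_of_le hs) (mem_of_coeff_ne_zero r hs0) (t • u).2
  refine ⟨⟨_, hb⟩, _, hs0, ?_⟩
  rw [mem_labelIdeal_iff hS]
  intro v hv
  rw [map_sub, MvPolynomial.coeff_sub, coeff_mono_mul, map_smul, mono_pow, incl_mono,
    MvPolynomial.coeff_smul, MvPolynomial.coeff_monomial]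
  change (if t • (u : Fin n →₀ ℕ) - s ≤ v then _ else _) -
    _ • (if t • (u : Fin n →₀ ℕ) = v then _ else _) = _
  by_cases hvt : t • (u : Fin n →₀ ℕ) = v
  · subst hvt
    simp [tsub_tsub_cancel_of_le hs]
  · rw [if_neg hvt, smul_zero, sub_zero, ite_eq_right_iff]
    intro hle
    by_contra hne
    have h1 : v - (t • (u : Fin n →₀ ℕ) - s) ≤ s := by
      rw [tsub_le_iff_left, tsub_add_cancel_of_le hs]
      exact hv
    refine hmin _ ⟨h1.trans hs, hne⟩ (lt_of_le_of_ne h1 fun h => hvt ?_)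
    rw [← tsub_add_cancel_of_le hle]
    change _ = v - (t • (u : Fin n →₀ ℕ) - s) + _
    rw [h, add_tsub_cancel_of_le hs]

lemma mono_pow_mem_of_labelIdeal_lt (hS : IsFullSemigroup S) (u : S) (t : ℕ)
    {I : Ideal (MonomialRing K S)} (hI : labelIdeal K u t < I) : mono K u ^ t ∈ I := by
  obtain ⟨r, hrI, hr⟩ := SetLike.exists_of_lt hI
  obtain ⟨b, c, hc, h⟩ := exists_mul_sub_mem_labelIdeal hS u t hr
  have h1 : c • mono K u ^ t ∈ I := by
    have := I.sub_mem (I.mul_mem_left (mono K b) hrI) (hI.le h)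
    simpa using this
  have := (I.restrictScalars K).smul_mem c⁻¹ h1
  simpa [smul_smul, inv_mul_cancel₀ hc] using this

/-- Every strictly larger ideal contains `μ ^ t`, so two such ideals cannot meet in `𝔞_t`. -/
lemma labelIdeal_infIrred (hS : IsFullSemigroup S) (u : S) (t : ℕ) :
    InfIrred (labelIdeal K u t) := by
  have hne := mono_pow_notMem_labelIdeal (K := K) hS u t
  refine ⟨fun h => hne (h le_top trivial), fun I J hIJ => ?_⟩
  by_contra! h
  refine hne ?_
  rw [← hIJ]
  exact ⟨mono_pow_mem_of_labelIdeal_lt hS u t (lt_of_le_of_ne (hIJ ▸ inf_le_left) h.1.symm),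
    mono_pow_mem_of_labelIdeal_lt hS u t (lt_of_le_of_ne (hIJ ▸ inf_le_right) h.2.symm)⟩

lemma mul_mono_pow_mem_labelIdeal (hS : IsFullSemigroup S) (u : S) (t : ℕ)
    {r : MonomialRing K S} (hr : r ∈ homogeneousMaximalIdeal K S) :
    r * mono K u ^ t ∈ labelIdeal K u t := by
  rw [mem_labelIdeal_iff hS, mul_comm, mono_pow]
  intro s hs
  rw [coeff_mono_mul]
  split_ifs with h
  · rw [le_antisymm hs h]
    simpa using mem_homogeneousMaximalIdeal.1 hr
  · rfl

lemma quotientSocle_labelIdeal (hS : IsFullSemigroup S) (u : S) (t : ℕ) :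
    Submodule.span (MonomialRing K S) {Ideal.Quotient.mk (labelIdeal K u t) (mono K u ^ t)} =
      quotientSocle (homogeneousMaximalIdeal K S) (labelIdeal K u t) := by
  apply le_antisymm
  · rw [Submodule.span_singleton_le_iff_mem]
    intro r hr
    rw [Algebra.smul_def, Ideal.Quotient.algebraMap_eq, ← map_mul, Ideal.Quotient.eq_zero_iff_mem]
    exact mul_mono_pow_mem_labelIdeal hS u t hr
  · intro x hx
    obtain ⟨r, rfl⟩ := Ideal.Quotient.mk_surjective x
    have hx' : ∀ b ∈ homogeneousMaximalIdeal K S, b * r ∈ labelIdeal K u t := by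
      intro b hb
      have := hx b hb
      rwa [Algebra.smul_def, Ideal.Quotient.algebraMap_eq, ← map_mul,
        Ideal.Quotient.eq_zero_iff_mem] at this
    by_cases hr : r ∈ labelIdeal K u t
    · rw [Ideal.Quotient.eq_zero_iff_mem.2 hr]
      exact Submodule.zero_mem _
    obtain ⟨b, c, hc, h⟩ := exists_mul_sub_mem_labelIdeal hS u t hr
    by_cases hb : (b : Fin n →₀ ℕ) = 0
    · have : mono K b = 1 := by rw [← mono_zero]; congr 1; exact Subtype.ext hb
      rw [this, one_mul] at h
      rw [Ideal.Quotient.mk_eq_mk_iff_sub_mem _ _ |>.2 h, Algebra.smul_def, map_mul,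
        ← Ideal.Quotient.algebraMap_eq, ← Algebra.smul_def]
      exact Submodule.smul_mem _ _ (Submodule.mem_span_singleton_self _)
    -- If `b ≠ 0`, its monomial lies in `𝔪` and kills the class of `r`, which would force `μ ^ t ∈
    -- 𝔞_t`.
    · refine absurd ?_ (mono_pow_notMem_labelIdeal (K := K) hS u t)
      have h1 := hx' _ (mono_mem_homogeneousMaximalIdeal.2 hb)
      have h2 := (labelIdeal K u t).sub_mem h1 h
      rw [sub_sub_cancel] at h2
      have := ((labelIdeal K u t).restrictScalars K).smul_mem c⁻¹ h2
      simpa [smul_smul, inv_mul_cancel₀ hc] using this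

lemma le_degree_of_mem_pow (k : ℕ) {r : MonomialRing K S}
    (hr : r ∈ homogeneousMaximalIdeal K S ^ k) {s : Fin n →₀ ℕ}
    (hs : (incl K S r).coeff s ≠ 0) : k ≤ s.degree := by
  induction k generalizing r s with
  | zero => exact Nat.zero_le _
  | succ k ih =>
    rw [pow_succ] at hr
    revert s
    refine Submodule.mul_induction_on
      (C := fun r => ∀ {s}, (incl K S r).coeff s ≠ 0 → k + 1 ≤ s.degree) hr ?_ ?_
    · intro a ha b hb s hs
      rw [map_mul, MvPolynomial.coeff_mul] at hs
      obtain ⟨⟨v, w⟩, hvw, h⟩ := Finset.exists_ne_zero_of_sum_ne_zero hs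
      have h1 := ih ha (left_ne_zero_of_mul h)
      have h2 : w ≠ 0 := by
        rintro rfl
        exact right_ne_zero_of_mul h (mem_homogeneousMaximalIdeal.1 hb)
      rw [← Finset.HasAntidiagonal.mem_antidiagonal.1 hvw, map_add]
      have h3 : Finsupp.degree w ≠ 0 := by rwa [Ne, Finsupp.degree_eq_zero_iff]
      dsimp only at *
      omega
    · intro a b ha hb s hs
      by_cases h : (incl K S a).coeff s = 0
      · exact hb (by simpa [h] using hs)
      · exact ha h

lemma homogeneousMaximalIdeal_pow_le_labelIdeal (hS : IsFullSemigroup S) (u : S) (t : ℕ) :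
    homogeneousMaximalIdeal K S ^ ((t • (u : Fin n →₀ ℕ)).degree + 1) ≤ labelIdeal K u t := by
  intro r hr
  rw [mem_labelIdeal_iff hS]
  intro s hs
  by_contra h
  have h1 := le_degree_of_mem_pow _ hr h
  have h2 : s.degree ≤ (t • (u : Fin n →₀ ℕ)).degree := Finsupp.degree_mono hs
  omega

lemma labelIdeal_le_homogeneousMaximalIdeal (hS : IsFullSemigroup S) (u : S) (t : ℕ) :
    labelIdeal K u t ≤ homogeneousMaximalIdeal K S := fun r hr =>
  mem_homogeneousMaximalIdeal.2 ((mem_labelIdeal_iff hS u t r).1 hr 0 zero_le)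

lemma labelIdeal_isPrimaryTo (hS : IsFullSemigroup S) (u : S) (t : ℕ) :
    IsPrimaryTo (homogeneousMaximalIdeal K S) (labelIdeal K u t) := by
  have hrad : (labelIdeal K u t).radical = homogeneousMaximalIdeal K S := by
    apply le_antisymm
    · exact (homogeneousMaximalIdeal_isPrime K S).radical_le_iff.2
        (labelIdeal_le_homogeneousMaximalIdeal hS u t)
    · exact fun r hr => ⟨_, homogeneousMaximalIdeal_pow_le_labelIdeal hS u t
        (Ideal.pow_mem_pow hr _)⟩
  refine ⟨Ideal.isPrimary_of_isMaximal_radical ?_, hrad⟩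
  rw [hrad]
  exact homogeneousMaximalIdeal_isMaximal

/-- Fullness is closure under those differences that exist in `ℕ^n`, so the minimal nonzero elements
generate; Dickson's lemma makes them finite in number. -/
lemma IsFullSemigroup.fg (hS : IsFullSemigroup S) : S.FG :=
  AddSubmonoid.fg_of_subtractive fun x hx y hxy => hS y x _ (add_comm y x) hx hxy

lemma exists_labelIdeal_le_pow (hS : IsFullSemigroup S) (u : S)
    (hu : ∀ i, 0 < (u : Fin n →₀ ℕ) i) (k : ℕ) :
    ∃ t : ℕ, 1 ≤ t ∧ labelIdeal K u t ≤ homogeneousMaximalIdeal K S ^ k := by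
  obtain ⟨G, hG⟩ := hS.fg
  -- Generators have degree at most `D`, so a monomial that is a product of `N` nontrivial
  -- generators has degree at most `D * N`: large degree forces a high power of `𝔪`.
  set D := G.sup Finsupp.degree with hD
  have key : ∀ s (hs : s ∈ S), ∃ N, mono K ⟨s, hs⟩ ∈ homogeneousMaximalIdeal K S ^ N ∧
      s.degree ≤ D * N := by
    intro s hs
    have hs' := hs
    rw [← hG] at hs'
    induction hs' using AddSubmonoid.closure_induction with
    | mem x hx =>
      by_cases h : x = 0
      · exact ⟨0, by simp, by simp [h]⟩
      · refine ⟨1, ?_, ?_⟩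
        · rw [pow_one]
          exact mono_mem_homogeneousMaximalIdeal.2 h
        · rw [mul_one]
          exact Finset.le_sup (f := Finsupp.degree) hx
    | zero => exact ⟨0, by simp, by simp⟩
    | add x y hx hy ihx ihy =>
      rw [hG] at hx hy
      obtain ⟨N, h1, h2⟩ := ihx hx
      obtain ⟨N', h3, h4⟩ := ihy hy
      refine ⟨N + N', ?_, ?_⟩
      · rw [pow_add]
        have : mono K (⟨x + y, hs⟩ : S) = mono K ⟨x, hx⟩ * mono K ⟨y, hy⟩ := by
          rw [← mono_add]; rfl
        rw [this]
        exact Ideal.mul_mem_mul h1 h3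
      · rw [map_add, mul_add]
        omega
  -- All exponents of `μ` being positive, a monomial not dividing `μ ^ (D * k + 1)` has some
  -- exponent above `D * k + 1`, hence degree above `D * k`.
  refine ⟨D * k + 1, by omega, fun r hr => ?_⟩
  refine mem_of_forall_mono_mem ((homogeneousMaximalIdeal K S ^ k).restrictScalars K) r
    fun s hs => ?_
  obtain ⟨N, h1, h2⟩ := key s s.2
  have h3 : ¬ (s : Fin n →₀ ℕ) ≤ (D * k + 1) • (u : Fin n →₀ ℕ) := fun h =>
    hs ((mem_labelIdeal_iff hS u _ r).1 hr s h)
  rw [Finsupp.le_def, not_forall] at h3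
  obtain ⟨i, hi⟩ := h3
  have h4 := Finsupp.le_degree i (s : Fin n →₀ ℕ)
  have h5 := hu i
  simp only [Finsupp.smul_apply, smul_eq_mul, not_le] at hi
  have h6 : D * k + 1 ≤ (D * k + 1) * (u : Fin n →₀ ℕ) i := Nat.le_mul_of_pos_right _ h5
  refine Ideal.pow_le_pow_right ?_ h1
  by_contra! hN
  have : D * N ≤ D * k := Nat.mul_le_mul_left _ hN.le
  omega

instance MonomialRing.finiteType_of_fg [Fact S.FG] : Algebra.FiniteType K (MonomialRing K S) := by
  obtain ⟨G, hG⟩ := Fact.out (p := S.FG)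
  refine (Subalgebra.fg_iff_finiteType (monomialSubalgebra K S)).1 ?_
  refine Subalgebra.fg_def.2
    ⟨(fun s => MvPolynomial.monomial s (1 : K)) '' (G : Set (Fin n →₀ ℕ)),
      G.finite_toSet.image _, le_antisymm (Algebra.adjoin_mono (Set.image_mono ?_)) ?_⟩
  · rw [← hG]; exact AddSubmonoid.subset_closure
  · refine Algebra.adjoin_le ?_
    rintro _ ⟨s, hs, rfl⟩
    rw [SetLike.mem_coe, ← hG] at hs
    induction hs using AddSubmonoid.closure_induction with
    | mem x hx => exact Algebra.subset_adjoin ⟨x, hx, rfl⟩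
    | zero => exact one_mem _
    | add x y _ _ hx hy =>
      have := mul_mem hx hy
      simpa [MvPolynomial.monomial_mul] using this

end LabelIdeal

/-! ### Maps to `R ⧸ 𝔞_t` and their lifts to `R` -/

/-- The map `M → R` dual to a `K`-linear functional, through its coefficients. -/
lemma exists_dual_linearMap {n : ℕ} {K : Type*} [Field K]
    {S : AddSubmonoid (Fin n →₀ ℕ)} (d : Fin n →₀ ℕ)
    {M : Type*} [AddCommGroup M] [Module (MonomialRing K S) M] [Module K M]
    [IsScalarTower K (MonomialRing K S) M] (f : M →ₗ[K] K) :
    ∃ g : M →ₗ[K] MonomialRing K S, ∀ v w : S, (v + w : Fin n →₀ ℕ) = d → ∀ y,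
      (incl K S (g y)).coeff v = f (mono K w • y) := by
  classical
  have hT : {p : S × S | (p.1 + p.2 : Fin n →₀ ℕ) = d}.Finite :=
    Set.Finite.of_injOn (f := fun p => ((p.1 : Fin n →₀ ℕ), (p.2 : Fin n →₀ ℕ)))
      (t := (Finset.HasAntidiagonal.antidiagonal d : Set ((Fin n →₀ ℕ) × (Fin n →₀ ℕ))))
      (fun p hp => by simpa using hp)
      (fun p _ q _ h => by
        simp only [Prod.mk.injEq] at h
        exact Prod.ext (Subtype.ext h.1) (Subtype.ext h.2)) (Finset.finite_toSet _)
  -- The generating function `y ↦ ∑ f (x^w y) x^v` over `v + w = d`; it is only `K`-linear.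
  refine ⟨∑ p ∈ hT.toFinset, LinearMap.smulRight
    (f ∘ₗ (Algebra.lsmul K K M (mono K p.2))) (mono K p.1), fun v w hvw y => ?_⟩
  simp only [LinearMap.sum_apply, map_sum, MvPolynomial.coeff_sum]
  rw [Finset.sum_eq_single (v, w)]
  · simp
  · rintro ⟨v', w'⟩ hp hne
    have : (v' : Fin n →₀ ℕ) ≠ v := by
      intro h
      have hp' : (v' + w' : Fin n →₀ ℕ) = d := hT.mem_toFinset.1 hp
      have hw : (w' : Fin n →₀ ℕ) = w := by
        rw [h, ← hvw] at hp'
        exact add_left_cancel hp'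
      exact hne (Prod.ext (Subtype.ext h) (Subtype.ext hw))
    simp [MvPolynomial.coeff_monomial, this]
  · intro h
    exact absurd (hT.mem_toFinset.2 hvw) h

/-- If `μ ^ t x ∉ 𝔞_t M`, then some map `M → R ⧸ 𝔞_t` sends `x` to a unit. This reflects the
self-injectivity of the Gorenstein ring `R ⧸ 𝔞_t`. -/
lemma exists_linearMap_quotient_labelIdeal {n : ℕ} {K : Type*} [Field K]
    {S : AddSubmonoid (Fin n →₀ ℕ)} (hS : IsFullSemigroup S) (u : S) (t : ℕ)
    {M : Type*} [AddCommGroup M] [Module (MonomialRing K S) M] [Module K M]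
    [IsScalarTower K (MonomialRing K S) M] {x : M}
    (hx : mono K u ^ t • x ∉ labelIdeal K u t • (⊤ : Submodule (MonomialRing K S) M)) :
    ∃ ψ : M →ₗ[MonomialRing K S] MonomialRing K S ⧸ labelIdeal K u t,
      ∀ r, Ideal.Quotient.mk _ r = ψ x → r ∉ homogeneousMaximalIdeal K S := by
  -- A functional that kills `𝔞_t M` but not `μ ^ t x`. Its dual `g` becomes `R`-linear modulo
  -- `𝔞_t`, and the constant term of `g x` is `f (μ ^ t x) ≠ 0`.
  obtain ⟨f, hf, hker⟩ := Submodule.exists_le_ker_of_notMem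
    (p := (labelIdeal K u t • (⊤ : Submodule (MonomialRing K S) M)).restrictScalars K) hx
  have hf0 : ∀ (s : S) (y : M), ¬ (s : Fin n →₀ ℕ) ≤ t • (u : Fin n →₀ ℕ) →
      f (mono K s • y) = 0 := by
    intro s y hs
    refine LinearMap.mem_ker.1 (hker ?_)
    rw [Submodule.restrictScalars_mem]
    exact Submodule.smul_mem_smul ((mono_mem_labelIdeal_iff hS u t s).2 hs) Submodule.mem_top
  obtain ⟨g, hg⟩ := exists_dual_linearMap (S := S) (t • (u : Fin n →₀ ℕ)) f
  have hlin : ∀ (r : S) (y : M), g (mono K r • y) - mono K r * g y ∈ labelIdeal K u t := by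
    intro r y
    rw [mem_labelIdeal_iff hS]
    intro v hv
    by_contra hne
    have hvS : v ∈ S := mem_of_coeff_ne_zero _ hne
    apply hne
    have hw : t • (u : Fin n →₀ ℕ) - v ∈ S :=
      hS _ v _ (tsub_add_cancel_of_le hv) hvS (t • u).2
    rw [map_sub, MvPolynomial.coeff_sub, coeff_mono_mul,
      hg ⟨v, hvS⟩ ⟨_, hw⟩ (add_tsub_cancel_of_le hv), ← mul_smul, ← mono_add]
    -- If `r ≤ v`, both coefficients evaluate `f` at the same monomial multiple of `y`. Otherwise
    -- that monomial does not divide `μ ^ t`, and `f` vanishes there.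
    split_ifs with hr
    · rw [hg ⟨v - r, hS _ r v (tsub_add_cancel_of_le hr) r.2 hvS⟩ (⟨_, hw⟩ + r), sub_self]
      change v - (r : Fin n →₀ ℕ) + (t • (u : Fin n →₀ ℕ) - v + r) = _
      rw [add_comm _ (r : Fin n →₀ ℕ), ← add_assoc, tsub_add_cancel_of_le hr,
        add_tsub_cancel_of_le hv]
    · rw [hf0, sub_zero]
      intro h
      apply hr
      change t • (u : Fin n →₀ ℕ) - v + r ≤ _ at h
      rw [← tsub_add_cancel_of_le hv] at h
      rw [add_tsub_cancel_right] at h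
      exact le_of_add_le_add_left h
  have hlin' : ∀ (r : MonomialRing K S) (y : M), g (r • y) - r * g y ∈ labelIdeal K u t := by
    intro r y
    let V : Submodule K (MonomialRing K S) := ((labelIdeal K u t).restrictScalars K).comap
      (g ∘ₗ (LinearMap.toSpanSingleton (MonomialRing K S) M y).restrictScalars K -
        LinearMap.mulRight K (g y))
    exact mem_of_forall_mono_mem V r fun s _ => hlin s y
  refine ⟨{ toFun := fun y => Ideal.Quotient.mk _ (g y)
            map_add' := fun y z => by rw [map_add, map_add]
            map_smul' := fun r y => ?_ }, ?_⟩
  · rw [RingHom.id_apply, Algebra.smul_def,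
      Ideal.Quotient.algebraMap_eq, ← map_mul, Ideal.Quotient.mk_eq_mk_iff_sub_mem]
    exact hlin' r y
  · intro r hr hrm
    change _ = Ideal.Quotient.mk _ _ at hr
    rw [Ideal.Quotient.mk_eq_mk_iff_sub_mem, mem_labelIdeal_iff hS] at hr
    have := hr 0 zero_le
    rw [map_sub, MvPolynomial.coeff_sub, mem_homogeneousMaximalIdeal.1 hrm, zero_sub,
      neg_eq_zero] at this
    apply hf
    rw [mono_pow, ← hg 0 (t • u) (zero_add _)]
    exact this

/-- Approximate maps `M → R ⧸ I` lift, up to a small error, to maps `M → R`. -/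
lemma Ideal.exists_forall_exists_linearMap_sub_mem {R M : Type*} [CommRing R] [IsNoetherianRing R]
    [AddCommGroup M] [Module R M] [Module.Finite R M] (m : Ideal R) :
    ∃ k : ℕ, ∀ I : Ideal R, I ≤ m ^ k → ∀ ψ : M →ₗ[R] R ⧸ I,
      ∃ φ : M →ₗ[R] R, ∀ y r, Ideal.Quotient.mk I r = ψ y → r - φ y ∈ m := by
  classical
  obtain ⟨b, π, hπ⟩ := Module.Finite.exists_fin' R M
  obtain ⟨c, ρ, hρ⟩ := Module.Finite.exists_fin' R (LinearMap.ker π)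
  -- restriction to the relations
  let rel : Fin c → Fin b → R := fun j => (ρ (Pi.single j 1) : Fin b → R)
  let A : (Fin b → R) →ₗ[R] (Fin c → R) := Matrix.mulVecLin (Matrix.of rel)
  have hA : ∀ v j, A v j = ∑ i, rel j i * v i := fun v j => rfl
  obtain ⟨k, hk⟩ := Ideal.exists_pow_inf_eq_pow_smul m (LinearMap.range A)
  -- One more than the Artin–Rees exponent, so that `𝔪 ^ (k + 1) R^c ∩ im A ⊆ 𝔪 · im A`. Then `A v =
  -- A w` with `w` having entries in `𝔪`, and the correction `v - w` is an exact solution.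
  refine ⟨k + 1, fun I hI ψ => ?_⟩
  have hIm : I ≤ m := hI.trans (Ideal.pow_le_self (Nat.succ_ne_zero k))
  choose v hv using fun i => Ideal.Quotient.mk_surjective (ψ (π (Pi.single i 1)))
  have hvz : ∀ z : Fin b → R, Ideal.Quotient.mk I (∑ i, z i * v i) = ψ (π z) := by
    intro z
    rw [map_sum]
    conv_rhs => rw [pi_eq_sum_univ' z, map_sum, map_sum]
    refine Finset.sum_congr rfl fun i _ => ?_
    rw [map_smul, map_smul, map_mul, hv, Algebra.smul_def]
    rfl
  have hAv : A v ∈ m ^ (k + 1) • (⊤ : Submodule R (Fin c → R)) := by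
    have : ∀ j, A v j ∈ m ^ (k + 1) := fun j => hI <| by
      rw [← Ideal.Quotient.eq_zero_iff_mem, hA, hvz, (ρ (Pi.single j 1)).2, map_zero]
    rw [pi_eq_sum_univ' (A v)]
    exact Submodule.sum_mem _ fun j _ => Submodule.smul_mem_smul (this j) trivial
  have hAw : A v ∈ m • LinearMap.range A := by
    have h1 : A v ∈ m ^ (k + 1) • (⊤ : Submodule R (Fin c → R)) ⊓ LinearMap.range A :=
      ⟨hAv, v, rfl⟩
    rw [hk (k + 1) (Nat.le_succ k), Nat.add_sub_cancel_left, pow_one] at h1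
    exact Submodule.smul_mono (le_refl m) inf_le_right h1
  rw [LinearMap.range_eq_map, ← Submodule.map_smul''] at hAw
  obtain ⟨w, hw, hwv⟩ := hAw
  have hwm : ∀ i, w i ∈ m := by
    intro i
    have h1 : LinearMap.proj (R := R) (φ := fun _ : Fin b => R) i w ∈
        (m • (⊤ : Submodule R (Fin b → R))).map (LinearMap.proj i) := ⟨w, hw, rfl⟩
    rw [Submodule.map_smul''] at h1
    simpa using Submodule.smul_mono (le_refl m) le_top h1
  let φ₀ : (Fin b → R) →ₗ[R] R := Fintype.linearCombination R (v - w)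
  have hφ₀ : ∀ z, φ₀ z = ∑ i, z i * (v i - w i) := fun z => by
    simp [φ₀, Fintype.linearCombination_apply]
  have hker : LinearMap.ker π ≤ LinearMap.ker φ₀ := by
    intro z hz
    obtain ⟨y, hy⟩ := hρ ⟨z, hz⟩
    have h1 : φ₀ ∘ₗ (LinearMap.ker π).subtype ∘ₗ ρ = 0 := by
      refine LinearMap.pi_ext' fun j => LinearMap.ext_ring ?_
      have := congrFun hwv j
      simp only [hA] at this
      simp only [LinearMap.comp_apply, LinearMap.single_apply, Submodule.subtype_apply, hφ₀,
        mul_sub, Finset.sum_sub_distrib, LinearMap.zero_apply, sub_eq_zero]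
      exact this.symm
    have := LinearMap.congr_fun h1 y
    simpa [hy] using this
  let e := π.quotKerEquivOfSurjective hπ
  refine ⟨(LinearMap.ker π).liftQ φ₀ hker ∘ₗ e.symm.toLinearMap, fun y r hr => ?_⟩
  obtain ⟨z, rfl⟩ := hπ y
  have he : e.symm (π z) = Submodule.Quotient.mk z := by
    rw [LinearEquiv.symm_apply_eq]; rfl
  rw [LinearMap.comp_apply, LinearEquiv.coe_coe, he, Submodule.liftQ_apply, hφ₀]
  rw [← hvz, Ideal.Quotient.mk_eq_mk_iff_sub_mem] at hr
  have : r - ∑ i, z i * (v i - w i) = (r - ∑ i, z i * v i) + ∑ i, z i * w i := by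
    simp only [mul_sub, Finset.sum_sub_distrib]; ring
  rw [this]
  exact m.add_mem (hIm hr) (m.sum_mem fun i _ => m.mul_mem_left _ (hwm i))

/-! ### Splitting off free summands, and part 3 -/

lemma not_hasNoFreeSummand_of_apply_eq_one {R M : Type*} [CommRing R] [AddCommGroup M] [Module R M]
    (φ : M →ₗ[R] R) (x : M) (h : φ x = 1) : ¬ HasNoFreeSummand R M := by
  rw [HasNoFreeSummand, not_not]
  let g : R →ₗ[R] M := LinearMap.toSpanSingleton R M x
  have hg : ∀ r, φ (g r) = r := fun r => by simp [g, h]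
  refine ⟨LinearMap.range g, LinearMap.ker φ, ?_,
    ⟨(LinearEquiv.ofInjective g (Function.LeftInverse.injective hg)).symm⟩⟩
  refine ⟨Submodule.disjoint_def.2 ?_, codisjoint_iff.2 (top_unique fun y _ => ?_)⟩
  · rintro _ ⟨r, rfl⟩ hr
    rw [LinearMap.mem_ker, hg] at hr
    rw [hr, map_zero]
  · refine Submodule.mem_sup.2 ⟨g (φ y), ⟨_, rfl⟩, y - g (φ y), ?_, by abel⟩
    rw [LinearMap.mem_ker, map_sub, hg, sub_self]

/-- The value `φ x` becomes a unit in the local ring, so rescaling `x` gives a section of the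
localized map. -/
lemma not_hasNoFreeSummand_localizedModule {R M : Type*} [CommRing R] [AddCommGroup M]
    [Module R M] (m : Ideal R) [m.IsPrime] (φ : M →ₗ[R] R) (x : M) (h : φ x ∉ m) :
    ¬ HasNoFreeSummand (Localization.AtPrime m) (LocalizedModule m.primeCompl M) := by
  let g : LocalizedModule m.primeCompl M →ₗ[R] Localization.AtPrime m :=
    IsLocalizedModule.map m.primeCompl (LocalizedModule.mkLinearMap m.primeCompl M)
      (Algebra.linearMap R (Localization.AtPrime m)) φ
  let g' := g.extendScalarsOfIsLocalization m.primeCompl (Localization.AtPrime m)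
  have hg : g' (LocalizedModule.mkLinearMap m.primeCompl M x) = algebraMap R _ (φ x) :=
    IsLocalizedModule.map_apply m.primeCompl (LocalizedModule.mkLinearMap m.primeCompl M)
      (Algebra.linearMap R (Localization.AtPrime m)) φ x
  obtain ⟨a, ha⟩ := IsLocalization.map_units (Localization.AtPrime m) (⟨φ x, h⟩ : m.primeCompl)
  refine not_hasNoFreeSummand_of_apply_eq_one g'
    ((↑a⁻¹ : Localization.AtPrime m) • LocalizedModule.mkLinearMap m.primeCompl M x) ?_
  rw [map_smul, hg, smul_eq_mul, ← ha, Units.inv_mul]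

section Graded

variable {n : ℕ} {K : Type*} [Field K] {S : AddSubmonoid (Fin n →₀ ℕ)}

lemma MonomialRing.ext_coeff {r r' : MonomialRing K S}
    (h : ∀ s, (incl K S r).coeff s = (incl K S r').coeff s) : r = r' :=
  incl_injective (MvPolynomial.ext _ _ h)

/-- The projection onto the span of the monomials whose exponent vectors satisfy `P`. -/
lemma MonomialRing.exists_filter (P : (Fin n →₀ ℕ) → Prop) [DecidablePred P] :
    ∃ g : MonomialRing K S →+ MonomialRing K S, ∀ r s,
      (incl K S (g r)).coeff s = if P s then (incl K S r).coeff s else 0 := by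
  classical
  have h : ∀ r : MonomialRing K S, ∃ r' : MonomialRing K S, ∀ s,
      (incl K S r').coeff s = if P s then (incl K S r).coeff s else 0 := by
    intro r
    have hf : ∀ s, (∑ v ∈ (incl K S r).support with P v,
        MvPolynomial.monomial v ((incl K S r).coeff v)).coeff s =
          if P s then (incl K S r).coeff s else 0 := by
      intro s
      simp only [MvPolynomial.coeff_sum, MvPolynomial.coeff_monomial, Finset.sum_ite_eq',
        Finset.mem_filter, MvPolynomial.mem_support_iff]
      split_ifs <;> simp_all
    obtain ⟨r', hr'⟩ := exists_incl_eq (S := S) _ (fun s hs => by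
      rw [hf] at hs
      exact mem_of_coeff_ne_zero r (s := s) fun h => hs (by simp [h]))
    exact ⟨r', fun s => by rw [hr', hf]⟩
  choose g hg using h
  refine ⟨AddMonoidHom.mk' g fun a b => ext_coeff fun s => ?_, hg⟩
  rw [map_add, MvPolynomial.coeff_add, hg, hg, hg, map_add, MvPolynomial.coeff_add]
  split_ifs <;> simp

/-- An element outside `𝔪` need not be a unit of `R`, but one homogeneous of degree 0 is a constant.
So `φ` is replaced by a homogeneous component, evaluated at a homogeneous element. -/
lemma not_hasNoFreeSummand_of_isGradedModule {M : Type*} [AddCommGroup M]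
    [Module (MonomialRing K S) M] {𝓜 : ℚ → AddSubgroup M}
    (h𝓜 : IsGradedModule (K := K) (S := S) 𝓜) (φ : M →ₗ[MonomialRing K S] MonomialRing K S)
    {x : M} (hx : φ x ∉ homogeneousMaximalIdeal K S) : ¬ HasNoFreeSummand (MonomialRing K S) M := by
  classical
  let e := AddEquiv.ofBijective (DirectSum.coeAddMonoidHom 𝓜) h𝓜.isInternal
  have he : ∀ (d : ℚ) (y : 𝓜 d), e (DirectSum.of (fun d => 𝓜 d) d y) = y := fun d y =>
    DirectSum.coeAddMonoidHom_of 𝓜 d y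
  obtain ⟨c, y, hy, hyφ⟩ : ∃ c, ∃ y ∈ 𝓜 c, φ y ∉ homogeneousMaximalIdeal K S := by
    by_contra! h
    have : ∀ z, φ (e z) ∈ homogeneousMaximalIdeal K S := by
      intro z
      induction z using DirectSum.induction_on with
      | zero => simp
      | of d y => rw [he]; exact h d y y.2
      | add a b ha hb => rw [map_add, map_add]; exact add_mem ha hb
    exact hx (by simpa using this (e.symm x))
  choose comp hcomp using fun q : ℚ =>
    exists_filter (K := K) (S := S) fun s => (s.degree : ℚ) = q
  have hmul : ∀ (d : ℕ) (r : MonomialRing K S), (incl K S r).IsHomogeneous d → ∀ (q : ℚ) z,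
      comp (d + q) (r * z) = r * comp q z := by
    intro d r hr q z
    refine ext_coeff fun s => ?_
    have key : ∀ p ∈ Finset.HasAntidiagonal.antidiagonal s,
        (incl K S r).coeff p.1 * (incl K S (comp q z)).coeff p.2 =
          if (s.degree : ℚ) = d + q then (incl K S r).coeff p.1 * (incl K S z).coeff p.2
            else 0 := by
      intro p hp
      rw [hcomp]
      by_cases hp1 : (incl K S r).coeff p.1 = 0
      · simp [hp1]
      · have hd : p.1.degree = d := by
          by_contra h
          exact hp1 (hr.coeff_eq_zero h)
        rw [← Finset.HasAntidiagonal.mem_antidiagonal.1 hp, map_add, hd, Nat.cast_add]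
        simp only [add_right_inj, mul_ite, mul_zero]
    rw [hcomp, map_mul, map_mul, MvPolynomial.coeff_mul, MvPolynomial.coeff_mul,
      Finset.sum_congr rfl key]
    split_ifs <;> simp
  -- The component of `φ` of degree `-c`, where `c` is the degree of `y`; it sends `y` to the
  -- constant term of `φ y`.
  let F : (DirectSum ℚ fun d => 𝓜 d) →+ MonomialRing K S := DirectSum.toAddMonoid fun d =>
    (comp (d - c)).comp (φ.toAddMonoidHom.comp (𝓜 d).subtype)
  have hF : ∀ (d : ℚ) (y : M), y ∈ 𝓜 d → F (e.symm y) = comp (d - c) (φ y) := by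
    intro d y hy
    have : e.symm y = DirectSum.of (fun d => 𝓜 d) d ⟨y, hy⟩ := by
      rw [AddEquiv.symm_apply_eq, he]
    rw [this]
    exact DirectSum.toAddMonoid_of _ _ _
  have hhom : ∀ (d : ℕ) (r : MonomialRing K S), (incl K S r).IsHomogeneous d → ∀ y,
      F (e.symm (r • y)) = r * F (e.symm y) := by
    intro d r hr y
    obtain ⟨z, rfl⟩ := e.surjective y
    induction z using DirectSum.induction_on with
    | zero => simp
    | of q y =>
      rw [he, hF _ _ (h𝓜.smul_mem d r hr q y y.2), hF _ _ y.2, map_smul, smul_eq_mul,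
        add_sub_assoc, hmul d r hr]
    | add a b ha hb =>
      rw [map_add, smul_add, map_add, map_add, map_add, map_add, mul_add, ha, hb]
  let V : Submodule K (MonomialRing K S) :=
    { carrier := {r | ∀ y, F (e.symm (r • y)) = r * F (e.symm y)}
      add_mem' := fun {a b} ha hb y => by rw [add_smul, map_add, map_add, ha, hb, add_mul]
      zero_mem' := fun y => by simp
      smul_mem' := fun k r hr y => by
        rw [Algebra.smul_def, mul_smul, hhom 0 _ _ (r • y), hr, mul_assoc]
        rw [AlgHom.commutes]
        exact MvPolynomial.isHomogeneous_C _ _ }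
  have hV : ∀ r, r ∈ V := fun r => mem_of_forall_mono_mem V r fun s _ =>
    hhom _ _ (isHomogeneous_mono s)
  let φ' : M →ₗ[MonomialRing K S] MonomialRing K S :=
    { toFun := fun y => F (e.symm y)
      map_add' := fun a b => by rw [map_add, map_add]
      map_smul' := fun r y => hV r y }
  set k := (incl K S (φ y)).coeff 0 with hk
  have hk0 : k ≠ 0 := fun h => hyφ (mem_homogeneousMaximalIdeal.2 h)
  have hφ' : φ' y = algebraMap K _ k := by
    refine (hF c y hy).trans (ext_coeff fun s => ?_)
    rw [hcomp, sub_self, AlgHom.commutes, MvPolynomial.algebraMap_eq, MvPolynomial.coeff_C]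
    by_cases hs : s = 0
    · simp [hs, hk]
    · rw [if_neg, if_neg (Ne.symm hs)]
      rwa [Nat.cast_eq_zero, Finsupp.degree_eq_zero_iff]
  refine not_hasNoFreeSummand_of_apply_eq_one φ' (algebraMap K (MonomialRing K S) k⁻¹ • y) ?_
  rw [map_smul, hφ', smul_eq_mul, ← map_mul, inv_mul_cancel₀ hk0, map_one]

/-- Condition `(*)` forces `μ ^ t M ⊆ 𝔞_t M` for all large `t`. -/
theorem exists_forall_mono_pow_smul_mem (hS : IsFullSemigroup S)
    (u : S) (hu : ∀ i, 0 < (u : Fin n →₀ ℕ) i) {M : Type*} [AddCommGroup M]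
    [Module (MonomialRing K S) M] [Module.Finite (MonomialRing K S) M]
    (hM : ((∃ 𝓜 : ℚ → AddSubgroup M, IsGradedModule (K := K) (S := S) 𝓜) ∧
          HasNoFreeSummand (MonomialRing K S) M) ∨
        HasNoFreeSummand (Localization.AtPrime (homogeneousMaximalIdeal K S))
          (LocalizedModule (homogeneousMaximalIdeal K S).primeCompl M)) :
    ∃ t₀ : ℕ, ∀ t : ℕ, t₀ ≤ t → ∀ x : M,
      mono K u ^ t • x ∈ labelIdeal K u t • (⊤ : Submodule (MonomialRing K S) M) := by
  have hφ : ∀ (φ : M →ₗ[MonomialRing K S] MonomialRing K S) (x : M),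
      φ x ∈ homogeneousMaximalIdeal K S := by
    intro φ x
    by_contra hx
    rcases hM with ⟨⟨𝓜, h𝓜⟩, h⟩ | h
    · exact not_hasNoFreeSummand_of_isGradedModule h𝓜 φ hx h
    · exact not_hasNoFreeSummand_localizedModule _ φ x hx h
  have : Fact S.FG := ⟨hS.fg⟩
  have : IsNoetherianRing (MonomialRing K S) := Algebra.FiniteType.isNoetherianRing K _
  let _ : Module K M := Module.compHom M (algebraMap K (MonomialRing K S))
  have : IsScalarTower K (MonomialRing K S) M := ⟨fun k r y => by
    rw [Algebra.smul_def, mul_smul]; rfl⟩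
  obtain ⟨k, hk⟩ := Ideal.exists_forall_exists_linearMap_sub_mem (M := M)
    (homogeneousMaximalIdeal K S)
  obtain ⟨t₀, -, ht₀⟩ := exists_labelIdeal_le_pow (K := K) hS u hu k
  refine ⟨t₀, fun t ht x => ?_⟩
  by_contra hx
  obtain ⟨ψ, hψ⟩ := exists_linearMap_quotient_labelIdeal hS u t hx
  obtain ⟨φ, h⟩ := hk _ ((labelIdeal_anti hS u ht).trans ht₀) ψ
  obtain ⟨r, hr⟩ := Ideal.Quotient.mk_surjective (ψ x)
  exact hψ r hr ((Submodule.sub_mem_iff_left _ (hφ φ x)).1 (h x r hr))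

end Graded

/-! ### Length over `R` as dimension over `K` -/

section Length

/-- Modulo `m` every scalar of `R` is a constant, so `R`-submodules and `K`-subspaces coincide. -/
lemma Module.length_eq_of_smul_top_eq_bot {K R V : Type*} [Field K] [CommRing R] [Algebra K R]
    [AddCommGroup V] [Module R V] [Module K V] [IsScalarTower K R V] {m : Ideal R}
    (hm : ∀ r : R, ∃ c : K, r - algebraMap K R c ∈ m)
    (hV : m • (⊤ : Submodule R V) = ⊥) : Module.length R V = Module.length K V := by
  have h0 : ∀ r ∈ m, ∀ x : V, r • x = 0 := fun r hr x => by
    rw [← Submodule.mem_bot R, ← hV]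
    exact Submodule.smul_mem_smul hr trivial
  let e : Submodule R V ≃o Submodule K V :=
    { toFun := Submodule.restrictScalars K
      invFun := fun P =>
        { P.toAddSubmonoid with
          smul_mem' := fun r x hx => by
            obtain ⟨c, hc⟩ := hm r
            have : r • x = c • x := by
              rw [← sub_eq_zero, ← algebraMap_smul R c x, ← sub_smul]
              exact h0 _ hc x
            rw [this]
            exact P.smul_mem c hx }
      left_inv := fun P => rfl
      right_inv := fun P => rfl
      map_rel_iff' := Iff.rfl }
  apply WithBot.coe_injective
  rw [Module.coe_length, Module.coe_length, Order.krullDim_eq_of_orderIso e]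

lemma Module.length_eq_of_pow_smul_top_eq_bot {K R : Type*} [Field K] [CommRing R] [Algebra K R]
    {m : Ideal R} (hm : ∀ r : R, ∃ c : K, r - algebraMap K R c ∈ m) (k : ℕ) :
    ∀ (V : Type*) [AddCommGroup V] [Module R V] [Module K V] [IsScalarTower K R V],
      m ^ k • (⊤ : Submodule R V) = ⊥ → Module.length R V = Module.length K V := by
  induction k with
  | zero =>
    intro V _ _ _ _ hV
    have : Subsingleton V := by
      rw [pow_zero, Ideal.one_eq_top, Submodule.top_smul] at hV
      exact (Submodule.subsingleton_iff R).1 (subsingleton_of_bot_eq_top hV.symm)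
    rw [Module.length_eq_zero, Module.length_eq_zero]
  | succ k ih =>
    intro V _ _ _ _ hV
    set W : Submodule R V := m • ⊤ with hW
    have h1 : m ^ k • (⊤ : Submodule R W) = ⊥ := by
      apply Submodule.map_injective_of_injective W.injective_subtype
      rw [Submodule.map_smul'', Submodule.map_top, Submodule.range_subtype, Submodule.map_bot, hW,
        ← Submodule.mul_smul, ← pow_succ, hV]
    have h2 : m • (⊤ : Submodule R (V ⧸ W)) = ⊥ := by
      rw [← Submodule.range_mkQ W, LinearMap.range_eq_map, ← Submodule.map_smul'', ← hW,
        Submodule.mkQ_map_self]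
    have hex : Function.Exact W.subtype W.mkQ := LinearMap.exact_subtype_mkQ W
    rw [Module.length_eq_add_of_exact W.subtype W.mkQ W.injective_subtype W.mkQ_surjective hex,
      Module.length_eq_add_of_exact (W.subtype.restrictScalars K) (W.mkQ.restrictScalars K)
        W.injective_subtype W.mkQ_surjective hex, ih W h1,
      Module.length_eq_of_smul_top_eq_bot hm h2]

/-- Length depends only on the lattice of submodules, which a semilinear bijection over a surjective
`σ` preserves. This absorbs the Frobenius twist in part 4. -/
lemma Module.length_quotient_ker_of_surjective {K L V W : Type*} [Ring K] [Ring L]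
    [AddCommGroup V] [AddCommGroup W] [Module K V] [Module L W] {σ : K →+* L} [RingHomSurjective σ]
    (f : V →ₛₗ[σ] W) (hf : Function.Surjective f) :
    Module.length K (V ⧸ LinearMap.ker f) = Module.length L W := by
  let g : (V ⧸ LinearMap.ker f) →ₛₗ[σ] W := (LinearMap.ker f).liftQ f le_rfl
  have hg : Function.Bijective g := by
    constructor
    · rw [← LinearMap.ker_eq_bot]
      exact Submodule.ker_liftQ_eq_bot' _ _ rfl
    · intro w
      obtain ⟨v, rfl⟩ := hf w
      exact ⟨Submodule.Quotient.mk v, rfl⟩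
  apply WithBot.coe_injective
  rw [Module.coe_length, Module.coe_length,
    Order.krullDim_eq_of_orderIso (Submodule.orderIsoMapComapOfBijective g hg)]

end Length

/-! ### The ring `R^{1/q}` and Frobenius -/

section RootRing

lemma algebraMap_rootRing_injective (R : Type*) [CommRing R] [IsDomain R] (p : ℕ) [Fact p.Prime]
    [CharP R p] (e : ℕ) : Function.Injective (algebraMap R (rootRing R p e)) := by
  have h : Function.Injective (algebraMap R (AlgebraicClosure (FractionRing R))) := by
    rw [IsScalarTower.algebraMap_eq R (FractionRing R) (AlgebraicClosure (FractionRing R))]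
    exact (algebraMap (FractionRing R) _).injective.comp (IsFractionRing.injective R _)
  exact fun a b hab => h (congrArg Subtype.val hab)

/-- The map is `y ↦ y ^ q`: injective because Frobenius is injective on a domain, surjective because
the algebraic closure contains all `q`-th roots. -/
lemma exists_rootRing_ringEquiv (R : Type*) [CommRing R] [IsDomain R] (p : ℕ) [Fact p.Prime]
    [CharP R p] (e : ℕ) :
    ∃ Φ : rootRing R p e ≃+* R, ∀ y, y ^ p ^ e = algebraMap R (rootRing R p e) (Φ y) := by
  have hinj : Function.Injective (algebraMap R (rootRing R p e)) :=
    algebraMap_rootRing_injective R p e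
  have hchar : CharP (rootRing R p e) p := charP_of_injective_algebraMap hinj p
  have h : ∀ y : rootRing R p e, ∃ r : R, y ^ p ^ e = algebraMap R (rootRing R p e) r := by
    rintro ⟨y, r, hr⟩
    exact ⟨r, Subtype.ext hr⟩
  choose Φ hΦ using h
  let Ψ : rootRing R p e →+* R :=
    { toFun := Φ
      map_one' := hinj (by rw [← hΦ, one_pow, map_one])
      map_zero' := hinj (by
        rw [← hΦ, zero_pow (pow_ne_zero _ (Fact.out (p := p.Prime)).ne_zero), map_zero])
      map_mul' := fun a b => hinj (by rw [← hΦ, mul_pow, hΦ, hΦ, map_mul])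
      map_add' := fun a b => hinj (by rw [← hΦ, add_pow_char_pow, hΦ, hΦ, map_add]) }
  refine ⟨RingEquiv.ofBijective Ψ ⟨fun a b hab => ?_, fun r => ?_⟩, hΦ⟩
  · change Φ a = Φ b at hab
    apply iterateFrobenius_inj (rootRing R p e) p e
    rw [iterateFrobenius_def, iterateFrobenius_def, hΦ, hΦ, hab]
  · obtain ⟨y, hy⟩ := IsAlgClosed.exists_pow_nat_eq
      (algebraMap R (AlgebraicClosure (FractionRing R)) r)
      (pow_pos (Fact.out (p := p.Prime)).pos e)
    refine ⟨⟨y, r, hy⟩, hinj ?_⟩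
    change algebraMap R (rootRing R p e) (Φ _) = _
    rw [← hΦ]
    exact Subtype.ext hy

lemma iterateFrobenius_finite (K R : Type*) [Field K] [CommRing R] [Algebra K R]
    [Algebra.FiniteType K R] (p : ℕ) [Fact p.Prime] [CharP K p] [PerfectField K] [CharP R p]
    (e : ℕ) : (iterateFrobenius R p e).Finite := by
  have : PerfectRing K p := PerfectField.toPerfectRing p
  apply RingHom.IsIntegral.to_finite
  · intro x
    -- Coefficients act through Frobenius, so the coefficient `x` contributes `x ^ q` and `x` is a
    -- root.
    refine ⟨Polynomial.X ^ p ^ e - Polynomial.C x, Polynomial.monic_X_pow_sub_C _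
      (pow_ne_zero _ (Fact.out (p := p.Prime)).ne_zero), ?_⟩
    simp [iterateFrobenius_def]
  · have hcomp : (iterateFrobenius R p e).comp (algebraMap K R) =
        (algebraMap K R).comp (iterateFrobenius K p e) := by
      ext c
      simp [iterateFrobenius_def]
    have h : ((iterateFrobenius R p e).comp (algebraMap K R)).FiniteType := by
      rw [hcomp]
      refine RingHom.FiniteType.comp ?_ (RingHom.FiniteType.of_surjective _
        (iterateFrobeniusEquiv K p e).surjective)
      rwa [RingHom.finiteType_algebraMap]
    exact RingHom.FiniteType.of_comp_finiteType h

lemma rootRing_finite (K R : Type*) [Field K] [CommRing R] [IsDomain R] [Algebra K R]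
    [Algebra.FiniteType K R] (p : ℕ) [Fact p.Prime] [CharP K p] [PerfectField K] [CharP R p]
    (e : ℕ) : Module.Finite R (rootRing R p e) := by
  obtain ⟨Φ, hΦ⟩ := exists_rootRing_ringEquiv R p e
  rw [← RingHom.finite_algebraMap]
  have : algebraMap R (rootRing R p e) =
      (Φ.symm : R →+* rootRing R p e).comp (iterateFrobenius R p e) := by
    ext r : 1
    have hinj : Function.Injective (algebraMap R (rootRing R p e)) :=
      algebraMap_rootRing_injective R p e
    apply Φ.injective
    apply hinj
    rw [← hΦ]
    simp [iterateFrobenius_def]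
  rw [this]
  exact (RingHom.Finite.of_surjective _ Φ.symm.surjective).comp (iterateFrobenius_finite K R p e)

/-- Under `Φ`, an element of `I` acting on `R^{1/q}` becomes its `q`-th power, so the extension of
`I` turns into the Frobenius power. -/
lemma mem_smul_top_rootRing_iff {R : Type*} [CommRing R] [IsDomain R] {p : ℕ} [Fact p.Prime]
    [CharP R p] {e : ℕ} (Φ : rootRing R p e ≃+* R)
    (hΦ : ∀ r, Φ (algebraMap R (rootRing R p e) r) = r ^ p ^ e) (I : Ideal R)
    (y : rootRing R p e) :
    y ∈ I • (⊤ : Submodule R (rootRing R p e)) ↔ Φ y ∈ I.frobPow (p ^ e) := by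
  constructor
  · intro h
    refine Submodule.smul_induction_on h (fun r hr z _ => ?_) fun a b ha hb => ?_
    · rw [Algebra.smul_def, map_mul, hΦ]
      exact Ideal.mul_mem_right _ _ (Ideal.subset_span ⟨r, hr, rfl⟩)
    · rw [map_add]
      exact add_mem ha hb
  · intro h
    rw [Ideal.smul_top_eq_map, Submodule.restrictScalars_mem]
    have hle : I.frobPow (p ^ e) ≤ (I.map (algebraMap R (rootRing R p e))).comap
        (Φ.symm : R →+* rootRing R p e) := by
      refine Ideal.span_le.2 ?_
      rintro _ ⟨r, hr, rfl⟩
      rw [SetLike.mem_coe, Ideal.mem_comap]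
      change Φ.symm (r ^ p ^ e) ∈ _
      rw [← hΦ, RingEquiv.symm_apply_apply]
      exact Ideal.mem_map_of_mem _ hr
    simpa using hle h

lemma mem_smul_top_pi_prod_iff {R M : Type*} [CommRing R] [AddCommGroup M] [Module R M] {ι : Type*}
    [Fintype ι] (I : Ideal R) (z : (ι → R) × M) :
    z ∈ I • (⊤ : Submodule R ((ι → R) × M)) ↔
      (∀ i, z.1 i ∈ I) ∧ z.2 ∈ I • (⊤ : Submodule R M) := by
  classical
  constructor
  · intro h
    refine ⟨fun i => ?_, ?_⟩
    · have := Submodule.mem_map_of_mem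
        (f := LinearMap.proj (R := R) (φ := fun _ : ι => R) i ∘ₗ LinearMap.fst R (ι → R) M) h
      rw [Submodule.map_smul''] at this
      simpa using Submodule.smul_mono (le_refl I) le_top this
    · have := Submodule.mem_map_of_mem (f := LinearMap.snd R (ι → R) M) h
      rw [Submodule.map_smul''] at this
      exact Submodule.smul_mono (le_refl I) le_top this
  · rintro ⟨h1, h2⟩
    have hz : z = (∑ i, z.1 i • LinearMap.inl R (ι → R) M (Pi.single i 1)) +
        LinearMap.inr R (ι → R) M z.2 := by
      simp_rw [← map_smul, ← map_sum, ← pi_eq_sum_univ' z.1]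
      simp
    rw [hz]
    refine add_mem (sum_mem fun i _ => Submodule.smul_mem_smul (h1 i) trivial) ?_
    have := Submodule.mem_map_of_mem (f := LinearMap.inr R (ι → R) M) h2
    rw [Submodule.map_smul''] at this
    exact Submodule.smul_mono (le_refl I) le_top this

end RootRing

/-! ### The free rank as a length -/

section FreeRank

variable {n : ℕ} {K : Type*} [Field K] {S : AddSubmonoid (Fin n →₀ ℕ)}

lemma mono_pow_mul_mem_labelIdeal_iff (hS : IsFullSemigroup S) (u : S) (t : ℕ)
    (r : MonomialRing K S) :
    mono K u ^ t * r ∈ labelIdeal K u t ↔ r ∈ homogeneousMaximalIdeal K S := by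
  refine ⟨fun h => ?_, fun h => mul_comm r _ ▸ mul_mono_pow_mem_labelIdeal hS u t h⟩
  have := (mem_labelIdeal_iff hS u t _).1 h _ le_rfl
  rw [mono_pow, coeff_mono_mul] at this
  exact mem_homogeneousMaximalIdeal.2 (by simpa using this)

/-- The multiplicity of `R` in `R^{1/q}` is a length. -/
theorem free_rank_eq_length (hS : IsFullSemigroup S)
    (u : S) (hu : ∀ i, 0 < (u : Fin n →₀ ℕ) i) (p : ℕ) [Fact p.Prime] [CharP K p]
    [PerfectField K] (e a : ℕ) {M : Type*} [AddCommGroup M] [Module (MonomialRing K S) M]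
    (E : rootRing (MonomialRing K S) p e ≃ₗ[MonomialRing K S] (Fin a → MonomialRing K S) × M)
    (hM : ((∃ 𝓜 : ℚ → AddSubgroup M, IsGradedModule (K := K) (S := S) 𝓜) ∧
          HasNoFreeSummand (MonomialRing K S) M) ∨
        HasNoFreeSummand (Localization.AtPrime (homogeneousMaximalIdeal K S))
          (LocalizedModule (homogeneousMaximalIdeal K S).primeCompl M)) :
    ∃ t₀ : ℕ, ∀ t : ℕ, t₀ ≤ t →
      (a : ℕ∞) = Module.length (MonomialRing K S)
        (MonomialRing K S ⧸
          ((labelIdeal K u t).frobPow (p ^ e)).colon {mono K u ^ (t * p ^ e)}) := by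
  have : Fact S.FG := ⟨hS.fg⟩
  have : IsNoetherianRing (MonomialRing K S) := Algebra.FiniteType.isNoetherianRing K _
  have := rootRing_finite K (MonomialRing K S) p e
  have : Module.Finite (MonomialRing K S) M := Module.Finite.of_surjective
    (LinearMap.snd (MonomialRing K S) (Fin a → MonomialRing K S) M ∘ₗ E.toLinearMap) (Prod.snd_surjective.comp E.surjective)
  obtain ⟨t₀, ht₀⟩ := exists_forall_mono_pow_smul_mem hS u hu hM
  refine ⟨t₀, fun t ht => ?_⟩
  set q := p ^ e with hq
  set m := homogeneousMaximalIdeal K S with hmdef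
  set J := ((labelIdeal K u t).frobPow q).colon {mono K u ^ (t * q)} with hJ
  obtain ⟨Φ, hΦ⟩ := exists_rootRing_ringEquiv (MonomialRing K S) p e
  have hΦ' : ∀ r, Φ (algebraMap _ (rootRing (MonomialRing K S) p e) r) = r ^ p ^ e := fun r =>
    algebraMap_rootRing_injective _ p e (by rw [← hΦ, map_pow])
  -- Extract `q`-th roots and decompose: only the free coordinates of `r^{1/q}` matter, since `μ ^ t
  -- M ⊆ 𝔞_t M` for `t ≥ t₀` and `𝔞_t : μ ^ t = 𝔪` in each coordinate.
  have hJmem : ∀ r, r ∈ J ↔ ∀ i, (E (Φ.symm r)).1 i ∈ m := by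
    intro r
    have h1 : r ∈ J ↔ mono K u ^ t • Φ.symm r ∈
        labelIdeal K u t • (⊤ : Submodule (MonomialRing K S) (rootRing (MonomialRing K S) p e)) := by
      rw [mem_smul_top_rootRing_iff Φ hΦ', hJ, Submodule.mem_colon_singleton, smul_eq_mul,
        Algebra.smul_def, map_mul, hΦ', RingEquiv.apply_symm_apply, ← pow_mul, mul_comm]
    have h2 : mono K u ^ t • Φ.symm r ∈
        labelIdeal K u t • (⊤ : Submodule (MonomialRing K S) (rootRing (MonomialRing K S) p e)) ↔
        E (mono K u ^ t • Φ.symm r) ∈ labelIdeal K u t • (⊤ : Submodule (MonomialRing K S)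
          ((Fin a → MonomialRing K S) × M)) := by
      have h3 : labelIdeal K u t • (⊤ : Submodule (MonomialRing K S)
          ((Fin a → MonomialRing K S) × M)) =
          (labelIdeal K u t • ⊤ : Submodule (MonomialRing K S) (rootRing (MonomialRing K S) p e)).map
            E.toLinearMap := by
        rw [Submodule.map_smul'', Submodule.map_top, LinearEquiv.range]
      rw [h3]
      exact (Function.Injective.mem_set_image E.injective).symm
    rw [h1, h2, mem_smul_top_pi_prod_iff, map_smul]
    refine ⟨fun h i => (mono_pow_mul_mem_labelIdeal_iff hS u t _).1 (h.1 i),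
      fun h => ⟨fun i => (mono_pow_mul_mem_labelIdeal_iff hS u t _).2 (h i), ht₀ t ht _⟩⟩
  have hσ : ∀ c : K, iterateFrobeniusEquiv K p e c = c ^ p ^ e := fun c => rfl
  -- Taking `q`-th roots turns a scalar `c` into `c^{1/q}`, so reading off constant terms is
  -- semilinear over inverse Frobenius, an automorphism as `K` is perfect.
  let σ : K →+* K := (iterateFrobeniusEquiv K p e).symm
  have : RingHomSurjective σ := ⟨(iterateFrobeniusEquiv K p e).symm.surjective⟩
  have hΦσ : ∀ (c : K) (r : MonomialRing K S),
      Φ.symm (c • r) = algebraMap K (MonomialRing K S) (σ c) • Φ.symm r := by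
    intro c r
    apply Φ.injective
    rw [RingEquiv.apply_symm_apply, Algebra.smul_def (σ c |> algebraMap K _), map_mul, hΦ',
      RingEquiv.apply_symm_apply, ← map_pow, ← hσ]
    change _ = algebraMap K _ (iterateFrobeniusEquiv K p e ((iterateFrobeniusEquiv K p e).symm c)) * _
    rw [RingEquiv.apply_symm_apply, Algebra.smul_def]
  let f : MonomialRing K S →ₛₗ[σ] (Fin a → K) :=
    { toFun := fun r i => (incl K S ((E (Φ.symm r)).1 i)).coeff 0
      map_add' := fun r s => by ext i; simp
      map_smul' := fun c r => by
        ext i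
        rw [hΦσ, map_smul, Prod.smul_fst, Pi.smul_apply, algebraMap_smul, map_smul,
          MvPolynomial.coeff_smul, Pi.smul_apply] }
  have hf : Function.Surjective f := by
    intro w
    refine ⟨Φ (E.symm (fun i => algebraMap K _ (w i), 0)), funext fun i => ?_⟩
    change (incl K S ((E (Φ.symm (Φ _))).1 i)).coeff 0 = w i
    rw [RingEquiv.symm_apply_apply, LinearEquiv.apply_symm_apply, AlgHom.commutes,
      MvPolynomial.algebraMap_eq, MvPolynomial.coeff_zero_C]
  have hker : LinearMap.ker f = J.restrictScalars K := by
    ext r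
    rw [LinearMap.mem_ker, Submodule.restrictScalars_mem, hJmem, funext_iff]
    rfl
  have hrad : m ≤ J.radical := by
    intro r hr
    rw [hmdef, ← (labelIdeal_isPrimaryTo hS u t).2] at hr
    obtain ⟨N, hN⟩ := hr
    -- From `r ^ N ∈ 𝔞_t` follows `r ^ (N * q) ∈ 𝔞_t^{[q]}`. So `J` contains a power of `𝔪`, and
    -- length over `R` is dimension over `K`.
    refine ⟨N * q, ?_⟩
    rw [hJ, Submodule.mem_colon_singleton, pow_mul]
    exact Ideal.mul_mem_right _ _ (Ideal.subset_span ⟨_, hN, rfl⟩)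
  obtain ⟨k, hk⟩ := Ideal.exists_pow_le_of_le_radical_of_fg hrad (IsNoetherian.noetherian m)
  have hkJ : m ^ k • (⊤ : Submodule (MonomialRing K S) (MonomialRing K S ⧸ J)) = ⊥ := by
    rw [← Submodule.range_mkQ J, LinearMap.range_eq_map, ← Submodule.map_smul'', eq_bot_iff,
      Submodule.map_le_iff_le_comap, Submodule.comap_bot, Submodule.ker_mkQ]
    simpa using hk
  have hm : ∀ r : MonomialRing K S, ∃ c : K, r - algebraMap K _ c ∈ m := fun r =>
    ⟨(incl K S r).coeff 0, mem_homogeneousMaximalIdeal.2 (by simp)⟩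
  rw [Module.length_eq_of_pow_smul_top_eq_bot hm k _ hkJ,
    ← (Submodule.Quotient.restrictScalarsEquiv K J).length_eq, ← hker,
    Module.length_quotient_ker_of_surjective f hf, Module.length_eq_finrank, Module.finrank_fin_fun]

end FreeRank

theorem lemma2p1 {n : ℕ} {K : Type*} [Field K]
    (S : AddSubmonoid (Fin n →₀ ℕ)) (hS : IsFullSemigroup S)
    (u : S) (hu : ∀ i, 0 < (u : Fin n →₀ ℕ) i) :
    (∀ t : ℕ, 1 ≤ t →
      InfIrred (labelIdeal K u t) ∧
      IsPrimaryTo (homogeneousMaximalIdeal K S) (labelIdeal K u t) ∧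
      Submodule.span (MonomialRing K S) {Ideal.Quotient.mk (labelIdeal K u t) (mono K u ^ t)} =
        quotientSocle (homogeneousMaximalIdeal K S) (labelIdeal K u t)) ∧
    ((∀ t : ℕ, 1 ≤ t → labelIdeal K u (t + 1) ≤ labelIdeal K u t) ∧
      (∀ k : ℕ, 1 ≤ k → ∃ t : ℕ, 1 ≤ t ∧
        labelIdeal K u t ≤ homogeneousMaximalIdeal K S ^ k) ∧
      (∀ t : ℕ, 1 ≤ t → ∃ k : ℕ, 1 ≤ k ∧
        homogeneousMaximalIdeal K S ^ k ≤ labelIdeal K u t)) ∧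
    (∀ (M : Type*) [AddCommGroup M] [Module (MonomialRing K S) M],
      Module.Finite (MonomialRing K S) M →
      (((∃ 𝓜 : ℚ → AddSubgroup M, IsGradedModule (K := K) (S := S) 𝓜) ∧
          HasNoFreeSummand (MonomialRing K S) M) ∨
        HasNoFreeSummand (Localization.AtPrime (homogeneousMaximalIdeal K S))
          (LocalizedModule (homogeneousMaximalIdeal K S).primeCompl M)) →
      ∃ t₀ : ℕ, ∀ t : ℕ, t₀ ≤ t → ∀ x : M,
        mono K u ^ t • x ∈ labelIdeal K u t • (⊤ : Submodule (MonomialRing K S) M)) ∧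
    (∀ (p : ℕ) [Fact p.Prime] [CharP K p] [PerfectField K] (e a : ℕ)
      (M : Type*) [AddCommGroup M] [Module (MonomialRing K S) M],
      Nonempty (rootRing (MonomialRing K S) p e ≃ₗ[MonomialRing K S]
        (Fin a → MonomialRing K S) × M) →
      (((∃ 𝓜 : ℚ → AddSubgroup M, IsGradedModule (K := K) (S := S) 𝓜) ∧
          HasNoFreeSummand (MonomialRing K S) M) ∨
        HasNoFreeSummand (Localization.AtPrime (homogeneousMaximalIdeal K S))
          (LocalizedModule (homogeneousMaximalIdeal K S).primeCompl M)) →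
      ∃ t₀ : ℕ, ∀ t : ℕ, t₀ ≤ t →
        (a : ℕ∞) = Module.length (MonomialRing K S)
          (MonomialRing K S ⧸
            ((labelIdeal K u t).frobPow (p ^ e)).colon {mono K u ^ (t * p ^ e)})) := by
  refine ⟨fun t _ => ⟨labelIdeal_infIrred hS u t, labelIdeal_isPrimaryTo hS u t,
    quotientSocle_labelIdeal hS u t⟩,
    ⟨fun t _ => labelIdeal_anti hS u (Nat.le_succ t),
      fun k _ => exists_labelIdeal_le_pow hS u hu k,
      fun t _ => ⟨_, Nat.le_add_left 1 _, homogeneousMaximalIdeal_pow_le_labelIdeal hS u t⟩⟩,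
    fun M _ _ _ hM => exists_forall_mono_pow_smul_mem hS u hu hM,
    fun p _ _ _ e a M _ _ ⟨E⟩ hM => free_rank_eq_length hS u hu p e a E hM⟩
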